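/- Let $n\ge 2$ and let $M$ be a compact (Hausdorff) smooth manifold of dimension $n+1$, possibly with boundary and corners. Let $W\in C^3(\mathbb R)$ be an even nonnegative double-well potential: its critical points are exactly $-1,0,1$; $W(\pm1)=0$ and $W''(\pm 1)>0$; and $0$ is a local maximum point. Put $\sigma=\int_{-1}^{1}\sqrt{W(t)/2}\,dt$. For a smooth Riemannian metric $g$ on $M$, $\varepsilon>0$ and $u\in H^1(M,g)$ let $$E_\varepsilon(u,g)=\int_M \frac{\varepsilon|\nabla u|_g^2}{2}+\frac{W(u)}{\varepsilon}\,d\mathrm{vol}_g\in[0,\infty].$$ For a symmetric set $A\subset H^1(M,g)$ (that is, $A=-A$) with $0\notin A$, let $\operatorname{ind}(A)=\sup\{k\ge 1:\tilde f^*(w^{k-1})\ne 0\in H^{k-1}(A/\{u\sim-u\};\mathbb Z/2)\}$, where $H^*$ is Alexander–Spanier cohomology, $\tilde f:A/\{u\sim -u\}\to\mathbb{RP}^\infty$ is induced by an odd continuous map $f:A\to S^\infty$, $S^\infty=\bigcup_N S^N$ carries the direct limit topology, $w$ is the generator of $H^1(\mathbb{RP}^\infty;\mathbb Z/2)$, and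 $\sup\emptyset=0$; put $\operatorname{ind}(A)=\infty$ if $0\in A$. For $p\in\mathbb N$ let $\mathcal F_p(M,g)$ be the family of all compact symmetric $A\subset H^1(M,g)$ with $\operatorname{ind}(A)\ge p+1$, let $$c_\varepsilon(p,M,g)=\inf_{A\in\mathcal F_p(M,g)}\ \sup_{u\in A}E_\varepsilon(u,g),$$ and define $$\underline\ell_p(M,g)=\frac1{2\sigma}\liminf_{\varepsilon\to0^+}c_\varepsilon(p,M,g),\qquad \overline\ell_p(M,g)=\frac1{2\sigma}\limsup_{\varepsilon\to0^+}c_\varepsilon(p,M,g).$$ Then, for every $p\in\mathbb N$, both functions $g\mapsto\underline\ell_p(M,g)$ and $g\mapsto\overline\ell_p(M,g)$ are continuous (as functions with values in $[0,\infty]$) on the space of smooth Riemannian metrics on $M$ with the $C^0$ topology, i.e. the topology of uniform convergence of the bilinear forms $g_x$, measured with any fixed reference metric on $M$. -/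

import Mathlib

open Set Filter Topology MeasureTheory
open scoped Manifold ContDiff ENNReal

noncomputable section

namespace AllenCahn

/-! ### Alexander–Spanier cochains with coefficients in `ZMod 2` -/

/-- Alexander–Spanier `k`-cochains: arbitrary functions `X^{k+1} → ℤ/2`. -/
abbrev Cochain (X : Type*) (k : ℕ) : Type _ := (Fin (k + 1) → X) → ZMod 2

/-- The coboundary `(δφ)(x₀,…,x_{k+1}) = ∑ᵢ φ(x₀,…,x̂ᵢ,…,x_{k+1})` (no signs modulo 2). -/
def delta (X : Type*) (k : ℕ) : Cochain X k →ₗ[ZMod 2] Cochain X (k + 1) where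
  toFun φ t := ∑ i : Fin (k + 2), φ (fun j => t (i.succAbove j))
  map_add' φ ψ := by
    funext t
    simp [Finset.sum_add_distrib]
  map_smul' a φ := by
    funext t
    simp [Finset.mul_sum]

/-- Locally zero cochains: those vanishing on a neighbourhood of the diagonal. -/
def locallyZero (X : Type*) [TopologicalSpace X] (k : ℕ) : Submodule (ZMod 2) (Cochain X k) where
  carrier := {φ | ∀ x : X, ∃ U ∈ 𝓝 x, ∀ t : Fin (k + 1) → X, (∀ i, t i ∈ U) → φ t = 0}
  zero_mem' := fun _ => ⟨univ, univ_mem, fun _ _ => rfl⟩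
  add_mem' := by
    intro φ ψ hφ hψ x
    obtain ⟨U, hU, h1⟩ := hφ x
    obtain ⟨V, hV, h2⟩ := hψ x
    refine ⟨U ∩ V, inter_mem hU hV, fun t ht => ?_⟩
    have e1 := h1 t (fun i => (ht i).1)
    have e2 := h2 t (fun i => (ht i).2)
    simp [e1, e2]
  smul_mem' := by
    intro a φ hφ x
    obtain ⟨U, hU, h1⟩ := hφ x
    refine ⟨U, hU, fun t ht => ?_⟩
    simp [h1 t ht]

/-- Cochains representing an Alexander–Spanier cocycle: `δφ` is locally zero. -/
def cocycles (X : Type*) [TopologicalSpace X] (k : ℕ) : Submodule (ZMod 2) (Cochain X k) :=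
  (locallyZero X (k + 1)).comap (delta X k)

/-- Cochains representing zero in Alexander–Spanier cohomology: locally zero cochains plus
coboundaries (in degree `0` there are no coboundaries).  The cohomology group `Hᵏ(X; ℤ/2)` is
`cocycles X k` modulo `coboundaries X k`, so a cocycle has a nonzero class if and only if it is not
an element of `coboundaries X k`. -/
def coboundaries (X : Type*) [TopologicalSpace X] :
    (k : ℕ) → Submodule (ZMod 2) (Cochain X k)
  | 0 => locallyZero X 0
  | k + 1 => LinearMap.range (delta X k) ⊔ locallyZero X (k + 1)

/-- Pullback of cochains along a map. -/
def pullback {X Y : Type*} (f : X → Y) {k : ℕ} (φ : Cochain Y k) : Cochain X k :=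
  fun t => φ (fun i => f (t i))

/-- The `k`-fold cup power of a `1`-cochain `c`:
`(c ⌣ ⋯ ⌣ c)(x₀,…,x_k) = c(x₀,x₁) c(x₁,x₂) ⋯ c(x_{k-1},x_k)`; for `k = 0` it is the unit. -/
def cupPow {X : Type*} (c : Cochain X 1) (k : ℕ) : Cochain X k :=
  fun t => ∏ i : Fin k, c ![t i.castSucc, t i.succ]

/-! ### The infinite sphere, the infinite projective space and the `ℤ/2`-index -/

/-- The infinite-dimensional sphere `S^∞ = ⋃ S^N`: finitely supported unit vectors. -/
def SInf : Type := {x : ℕ →₀ ℝ // ∑ i ∈ x.support, x i ^ 2 = 1}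

/-- The inclusion `S^N ⊆ S^∞`. -/
def sphereIncl (N : ℕ) (s : Metric.sphere (0 : EuclideanSpace ℝ (Fin (N + 1))) 1) : SInf :=
  ⟨(Finsupp.equivFunOnFinite.symm fun i => (s : EuclideanSpace ℝ (Fin (N + 1))) i).embDomain
      Fin.valEmbedding, by
    have h : ‖(s : EuclideanSpace ℝ (Fin (N + 1)))‖ = 1 := by simp
    rw [EuclideanSpace.norm_eq, Real.sqrt_eq_one] at h
    rw [Finsupp.support_embDomain, Finset.sum_map]
    simp only [Finsupp.embDomain_apply_self, Finsupp.equivFunOnFinite_symm_apply_apply]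
    refine Eq.trans ?_ h
    refine Finset.sum_subset_zero_on_sdiff (Finset.subset_univ _) ?_ ?_
    · intro i hi
      simpa using hi
    · intro i _
      simp⟩

/-- The direct limit topology on `S^∞`. -/
instance : TopologicalSpace SInf :=
  ⨆ N : ℕ, TopologicalSpace.coinduced (sphereIncl N) inferInstance

instance : InvolutiveNeg SInf where
  neg x := ⟨-x.1, by simpa using x.2⟩
  neg_neg x := Subtype.ext (neg_neg x.1)

/-- The relation `x ~ ±x`. -/
def antipodal (X : Type*) [InvolutiveNeg X] : Setoid X where
  r x y := x = y ∨ x = -y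
  iseqv :=
    { refl := fun _ => Or.inl rfl
      symm := by
        rintro x y (h | h)
        · exact Or.inl h.symm
        · exact Or.inr (by rw [h, neg_neg])
      trans := by
        rintro x y z (rfl | rfl) (rfl | rfl)
        · exact Or.inl rfl
        · exact Or.inr rfl
        · exact Or.inr rfl
        · exact Or.inl (neg_neg _) }

/-- Infinite-dimensional real projective space, with the quotient topology. -/
abbrev RPInf : Type := Quotient (antipodal SInf)

/-- The orbit space `A / {x ~ -x}` of a subset `A`, with the quotient topology. -/
abbrev OrbitSpace {X : Type*} [InvolutiveNeg X] (A : Set X) : Type _ :=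
  Quotient (Setoid.comap (Subtype.val : A → X) (antipodal X))

/-- `f : A → S^∞` is odd. -/
def IsOdd {X : Type*} [InvolutiveNeg X] {A : Set X} (f : A → SInf) : Prop :=
  ∀ a b : A, (a : X) = -(b : X) → f a = -f b

/-- The map `A/± → ℝℙ^∞` induced by an odd map `A → S^∞`. -/
def orbitMap {X : Type*} [InvolutiveNeg X] {A : Set X} (f : A → SInf) (hf : IsOdd f) :
    OrbitSpace A → RPInf :=
  Quotient.map' f (by
    rintro a b (h | h)
    · exact Or.inl (congrArg f (Subtype.ext h))
    · exact Or.inr (hf a b h))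

/-- `f̃^*(w^k) ≠ 0` in `Hᵏ(A/±; ℤ/2)`, where `f : A → S^∞` is odd and continuous, `f̃` is the induced
map `A/± → ℝℙ^∞` (unique up to homotopy) and `w` is the generator, i.e. the only nonzero element,
of `H¹(ℝℙ^∞; ℤ/2)`; here `w` is represented by the cocycle `c`. -/
def PowNonzero {X : Type*} [TopologicalSpace X] [InvolutiveNeg X] (A : Set X) (k : ℕ) : Prop :=
  ∃ c ∈ cocycles RPInf 1, c ∉ coboundaries RPInf 1 ∧
    ∃ (f : A → SInf) (hf : IsOdd f), Continuous f ∧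
      pullback (orbitMap f hf) (cupPow c k) ∉ coboundaries (OrbitSpace A) k

open scoped Classical in
/-- The cohomological `ℤ/2`-index `sup {k : f̃^*(w^{k-1}) ≠ 0}` of a symmetric set; it is `∞` if
`0 ∈ A`, and `0` (the supremum of the empty set) if `A` is empty. -/
def z2Index {X : Type*} [TopologicalSpace X] [InvolutiveNeg X] [Zero X] (A : Set X) : ℕ∞ :=
  if (0 : X) ∈ A then ⊤ else ⨆ k ∈ {k : ℕ | PowNonzero A k}, ((k + 1 : ℕ) : ℕ∞)

/-! ### Riemannian geometry -/

section Geometry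

variable {n : ℕ} {H : Type*} [TopologicalSpace H]
  (I : ModelWithCorners ℝ (EuclideanSpace ℝ (Fin (n + 1))) H)
  (M : Type*) [TopologicalSpace M] [ChartedSpace H M] [IsManifold I ∞ M]

/-- Smooth Riemannian metrics on the `(n+1)`-dimensional manifold `M`. -/
abbrev RiemMetric : Type _ :=
  Bundle.ContMDiffRiemannianMetric I ∞ (EuclideanSpace ℝ (Fin (n + 1)))
    (fun x : M => TangentSpace I x)

variable {I M}

/-- The `C⁰` distance of two metrics, measured with respect to a reference metric `h`: the supremum
over all points `x` of the norm of the bilinear form `g_x - g'_x` with respect to `h_x`. -/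
def c0Dist (h g g' : RiemMetric I M) : ℝ≥0∞ :=
  ⨆ (x : M) (v : TangentSpace I x) (w : TangentSpace I x)
    (_ : h.inner x v v ≤ 1) (_ : h.inner x w w ≤ 1),
    ENNReal.ofReal |g.inner x v w - g'.inner x v w|

/-- The pseudo-emetric structure on the set of metrics given by the `C⁰` distance. -/
@[reducible] def c0PseudoEMetricSpace (h : RiemMetric I M) :
    PseudoEMetricSpace (RiemMetric I M) where
  edist := c0Dist h
  edist_self g := by simp [c0Dist]
  edist_comm g g' := by simp only [c0Dist, abs_sub_comm]
  edist_triangle g₁ g₂ g₃ := by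
    refine iSup_le fun x => iSup_le fun v => iSup_le fun w => iSup_le fun hv => iSup_le fun hw => ?_
    refine (ENNReal.ofReal_le_ofReal (abs_sub_le _ (g₂.inner x v w) _)).trans ?_
    rw [ENNReal.ofReal_add (abs_nonneg _) (abs_nonneg _)]
    refine add_le_add ?_ ?_
    · exact le_iSup_of_le x (le_iSup_of_le v (le_iSup_of_le w
        (le_iSup_of_le hv (le_iSup_of_le hw le_rfl))))
    · exact le_iSup_of_le x (le_iSup_of_le v (le_iSup_of_le w
        (le_iSup_of_le hv (le_iSup_of_le hw le_rfl))))

/-- The `C⁰` topology on the space of smooth metrics, i.e. the topology of the `C⁰` norm with respect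
to the reference metric `h` (on a compact manifold it does not depend on `h`). -/
@[reducible] def c0Topology (h : RiemMetric I M) : TopologicalSpace (RiemMetric I M) :=
  (c0PseudoEMetricSpace h).toUniformSpace.toTopologicalSpace

variable (I) in
/-- The differential at `y` of the inverse of the preferred chart at `x`. -/
def chartInvDeriv (x : M) (y : EuclideanSpace ℝ (Fin (n + 1))) :
    EuclideanSpace ℝ (Fin (n + 1)) →L[ℝ] TangentSpace I ((extChartAt I x).symm y) :=
  mfderivWithin 𝓘(ℝ, EuclideanSpace ℝ (Fin (n + 1))) I (extChartAt I x).symm (range I) y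

/-- The Gram matrix `g_{ij}(y) = g(∂_i, ∂_j)` of `g` in the preferred chart at `x`. -/
def gram (g : RiemMetric I M) (x : M) (y : EuclideanSpace ℝ (Fin (n + 1))) :
    Matrix (Fin (n + 1)) (Fin (n + 1)) ℝ :=
  Matrix.of fun i j => g.inner ((extChartAt I x).symm y)
    (chartInvDeriv I x y (EuclideanSpace.single i 1))
    (chartInvDeriv I x y (EuclideanSpace.single j 1))

variable [MeasurableSpace M]

/-- The measure `√(det g_{ij}) dy` on the domain of the preferred chart at `x`. -/
def chartVol (g : RiemMetric I M) (x : M) : Measure M :=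
  (((volume : Measure (EuclideanSpace ℝ (Fin (n + 1)))).restrict
    (extChartAt I x).target).withDensity
      fun y => ENNReal.ofReal (Real.sqrt (gram g x y).det)).map (extChartAt I x).symm

/-- The Riemannian volume measure.  The measures `√(det g_{ij}) dy` of the charts agree on overlaps,
and the Riemannian measure, which restricts to each of them, is their least upper bound. -/
def vol (g : RiemMetric I M) : Measure M := ⨆ x : M, chartVol g x

/-- The norm `|η|_g` of a covector, which equals the `g`-norm of the dual tangent vector; for
`η = du` it is `|∇u|_g`. -/
def conorm (g : RiemMetric I M) (x : M) (η : TangentSpace I x →L[ℝ] ℝ) : ℝ≥0∞ :=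
  ⨆ (v : TangentSpace I x) (_ : g.inner x v v ≤ 1), ENNReal.ofReal |η v|

/-! ### The Sobolev space `H¹` and the Allen–Cahn energy -/

/-- `η` is a weak differential of the function `u` (in the interior of `M`): in every chart
the components of `η` are locally integrable and are the weak partial derivatives of `u`. -/
structure IsWeakDifferential (u : M → ℝ) (η : ∀ q : M, TangentSpace I q →L[ℝ] ℝ) : Prop where
  locallyIntegrable : ∀ x : M,
    LocallyIntegrableOn (fun y => u ((extChartAt I x).symm y)) (interior (extChartAt I x).target)
  locallyIntegrable_deriv : ∀ (x : M) (v : EuclideanSpace ℝ (Fin (n + 1))),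
    LocallyIntegrableOn (fun y => η ((extChartAt I x).symm y) (chartInvDeriv I x y v))
      (interior (extChartAt I x).target)
  integral_eq : ∀ (x : M) (v : EuclideanSpace ℝ (Fin (n + 1)))
    (ψ : EuclideanSpace ℝ (Fin (n + 1)) → ℝ), ContDiff ℝ ∞ ψ → HasCompactSupport ψ →
    tsupport ψ ⊆ interior (extChartAt I x).target →
    ∫ y, u ((extChartAt I x).symm y) * fderiv ℝ ψ y v =
      -∫ y, η ((extChartAt I x).symm y) (chartInvDeriv I x y v) * ψ y

/-- The Dirichlet integral `∫ |∇u|²_g dvol_g` of an almost everywhere class `u`.  All weak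
differentials of `u` agree almost everywhere, so this is an infimum of equal numbers; it is `∞`
if `u` is not weakly differentiable. -/
def dirichlet (g : RiemMetric I M) (u : Lp ℝ 2 (vol g)) : ℝ≥0∞ :=
  ⨅ (v : M → ℝ) (η : ∀ q : M, TangentSpace I q →L[ℝ] ℝ)
    (_ : v =ᵐ[vol g] u) (_ : IsWeakDifferential v η), ∫⁻ q, conorm g q (η q) ^ 2 ∂(vol g)

/-- The Sobolev space `H¹(M, g)`: square-integrable functions (modulo equality almost everywhere)
with a square-integrable weak gradient. -/
def SobolevH1 (g : RiemMetric I M) : Type _ := {u : Lp ℝ 2 (vol g) // dirichlet g u < ⊤}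

/-- The `H¹` distance `(‖u - v‖²_{L²} + ‖∇(u - v)‖²_{L²})^{1/2}`. -/
def h1Dist {g : RiemMetric I M} (u v : SobolevH1 g) : ℝ≥0∞ :=
  (‖u.1 - v.1‖ₑ ^ 2 + dirichlet g (u.1 - v.1)) ^ (1 / 2 : ℝ)

/-- The norm topology of `H¹(M, g)`. -/
instance (g : RiemMetric I M) : TopologicalSpace (SobolevH1 g) where
  IsOpen U := ∀ u ∈ U, ∃ r : ℝ≥0∞, 0 < r ∧ ∀ v, h1Dist u v < r → v ∈ U
  isOpen_univ := fun _ _ => ⟨1, one_pos, fun _ _ => mem_univ _⟩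
  isOpen_inter := by
    intro U V hU hV u hu
    obtain ⟨r, hr, h1⟩ := hU u hu.1
    obtain ⟨s, hs, h2⟩ := hV u hu.2
    exact ⟨min r s, lt_min hr hs, fun v hv =>
      ⟨h1 v (hv.trans_le (min_le_left _ _)), h2 v (hv.trans_le (min_le_right _ _))⟩⟩
  isOpen_sUnion := by
    intro S hS u hu
    obtain ⟨U, hU, huU⟩ := hu
    obtain ⟨r, hr, h⟩ := hS U hU u huU
    exact ⟨r, hr, fun v hv => ⟨U, hU, h v hv⟩⟩

set_option linter.unusedSectionVars false

theorem dirichlet_zero_lt_top (g : RiemMetric I M) : dirichlet g 0 < ⊤ := by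
  have h0 : IsWeakDifferential (fun _ : M => (0 : ℝ)) (fun q => (0 : TangentSpace I q →L[ℝ] ℝ)) :=
    { locallyIntegrable := fun x => (locallyIntegrable_const 0).locallyIntegrableOn _
      locallyIntegrable_deriv := fun x v => (locallyIntegrable_const 0).locallyIntegrableOn _
      integral_eq := fun x v ψ _ _ _ => by
        have e : ∀ y, (0 : TangentSpace I ((extChartAt I x).symm y) →L[ℝ] ℝ)
            (chartInvDeriv I x y v) * ψ y = 0 := fun y => zero_mul (ψ y)
        rw [integral_congr_ae (Eventually.of_forall e)]
        simp }
  refine lt_of_le_of_lt (iInf_le_of_le _ (iInf_le_of_le _ (iInf_le_of_le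
    (Lp.coeFn_zero ℝ 2 (vol g)).symm (iInf_le_of_le h0 le_rfl)))) ?_
  simp [conorm]

theorem IsWeakDifferential.neg {u : M → ℝ} {η : ∀ q : M, TangentSpace I q →L[ℝ] ℝ}
    (h : IsWeakDifferential u η) : IsWeakDifferential (fun q => -u q) (fun q => -η q) where
  locallyIntegrable x := (h.locallyIntegrable x).neg
  locallyIntegrable_deriv x v := (h.locallyIntegrable_deriv x v).neg
  integral_eq x v ψ h1 h2 h3 := by
    have := h.integral_eq x v ψ h1 h2 h3
    simp only [neg_apply, neg_mul, integral_neg, this]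

theorem dirichlet_neg_le (g : RiemMetric I M) (u : Lp ℝ 2 (vol g)) :
    dirichlet g (-u) ≤ dirichlet g u := by
  refine le_iInf fun v => le_iInf fun η => le_iInf fun hv => le_iInf fun hη => ?_
  refine iInf_le_of_le _ (iInf_le_of_le _ (iInf_le_of_le ?_ (iInf_le_of_le hη.neg ?_)))
  · filter_upwards [hv, Lp.coeFn_neg u] with q h1 h2
    rw [h2, Pi.neg_apply, h1]
  · simp [conorm]

instance (g : RiemMetric I M) : Zero (SobolevH1 g) := ⟨⟨0, dirichlet_zero_lt_top g⟩⟩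

instance (g : RiemMetric I M) : InvolutiveNeg (SobolevH1 g) where
  neg u := ⟨-u.1, (dirichlet_neg_le g u.1).trans_lt u.2⟩
  neg_neg u := Subtype.ext (neg_neg u.1)

/-- The Allen–Cahn energy `E_ε(u) = ∫ ε|∇u|²/2 + W(u)/ε`. -/
def energy (g : RiemMetric I M) (W : ℝ → ℝ) (ε : ℝ) (u : SobolevH1 g) : ℝ≥0∞ :=
  ENNReal.ofReal (ε / 2) * dirichlet g u.1 + ∫⁻ q, ENNReal.ofReal (W (u.1 q) / ε) ∂(vol g)

/-- The family `𝓕_p` of compact symmetric subsets of `H¹(M, g)` of index at least `p + 1`. -/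
def minmaxFamily (g : RiemMetric I M) (p : ℕ) : Set (Set (SobolevH1 g)) :=
  {A | IsCompact A ∧ (∀ u ∈ A, -u ∈ A) ∧ ((p + 1 : ℕ) : ℕ∞) ≤ z2Index A}

/-- The min-max value `c_ε(p, M, g) = inf_{A ∈ 𝓕_p} sup_{u ∈ A} E_ε(u)`. -/
def minmaxValue (g : RiemMetric I M) (W : ℝ → ℝ) (p : ℕ) (ε : ℝ) : ℝ≥0∞ :=
  ⨅ A ∈ minmaxFamily g p, ⨆ u ∈ A, energy g W ε u

/-- Double-well potentials: even nonnegative `C³` functions with exactly the three critical points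
`0, ±1`, where `±1` are nondegenerate minima with value `0`, and `0` is a local maximum. -/
structure IsDoubleWell (W : ℝ → ℝ) : Prop where
  contDiff : ContDiff ℝ 3 W
  even : ∀ t, W (-t) = W t
  nonneg : ∀ t, 0 ≤ W t
  critical : {t | deriv W t = 0} = {-1, 0, 1}
  zero_one : W 1 = 0
  zero_neg_one : W (-1) = 0
  nondeg_one : 0 < iteratedDeriv 2 W 1
  nondeg_neg_one : 0 < iteratedDeriv 2 W (-1)
  isLocalMax : IsLocalMax W 0

/-- `σ = ∫_{-1}^1 √(W(t)/2) dt`. -/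
def sigma (W : ℝ → ℝ) : ℝ := ∫ t in (-1 : ℝ)..1, Real.sqrt (W t / 2)

/-- The lower phase transition spectrum `(2σ)⁻¹ liminf_{ε → 0⁺} c_ε(p, M, g)`. -/
def lowerSpectrum (W : ℝ → ℝ) (p : ℕ) (g : RiemMetric I M) : ℝ≥0∞ :=
  ENNReal.ofReal (1 / (2 * sigma W)) * liminf (minmaxValue g W p) (𝓝[>] 0)

/-- The upper phase transition spectrum `(2σ)⁻¹ limsup_{ε → 0⁺} c_ε(p, M, g)`. -/
def upperSpectrum (W : ℝ → ℝ) (p : ℕ) (g : RiemMetric I M) : ℝ≥0∞ :=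
  ENNReal.ofReal (1 / (2 * sigma W)) * limsup (minmaxValue g W p) (𝓝[>] 0)

end Geometry

end AllenCahn

end

noncomputable section
namespace AllenCahn

/-! ### Determinants of positive semidefinite matrices -/

/-! Suppose `μ⁻² g ≤ g' ≤ μ² g` as quadratic forms (`Comparable μ g g'`). Then volumes change by a
factor of at most `μ^(n+1)` and norms of covectors by at most `μ`, so the energy of one and the same
function changes by at most `μ^(n+3)`, for every `ε`. The spaces `H¹(M, g)` and `H¹(M, g')` contain
the same functions and have equivalent norms. The identity between them is an odd homeomorphism
fixing `0`, so it preserves compactness, symmetry and index, and carries `𝓕_p` to `𝓕_p`. Hence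
`c_ε(p, g') ≤ μ^(n+3) c_ε(p, g)` with a constant independent of `ε` (`Comparable.minmaxValue_le`),
and the bound survives both the liminf and the limsup.

On a compact manifold, metrics that are `C⁰`-close to `g` are comparable to it with `μ` as close to
`1` as desired (`eventually_inner_self_le`). Comparability is symmetric, so each spectrum is
squeezed from both sides, which gives continuity even where the value is `∞`
(`tendsto_of_eventually_le_mul`). -/

theorem one_le_det_of_posSemidef_sub_one {m : Type*} [Fintype m] [DecidableEq m]
    {A : Matrix m m ℝ} (hA : (A - 1).PosSemidef) : 1 ≤ A.det := by
  have hH : A.IsHermitian := by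
    simpa using hA.isHermitian.add (Matrix.isHermitian_one (n := m) (α := ℝ))
  rw [hH.det_eq_prod_eigenvalues]
  -- Each eigenvalue is at least `1`: test `A - 1` on the corresponding unit eigenvector.
  refine Finset.one_le_prod fun i => ?_
  have h1 := hA.dotProduct_mulVec_nonneg (hH.eigenvectorBasis i)
  have h2 := hH.mulVec_eigenvectorBasis i
  have h3 : star ⇑(hH.eigenvectorBasis i) ⬝ᵥ ⇑(hH.eigenvectorBasis i) = 1 := by
    have := hH.eigenvectorBasis.orthonormal.1 i
    have h4 := real_inner_self_eq_norm_sq (hH.eigenvectorBasis i)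
    rw [this, EuclideanSpace.inner_eq_star_dotProduct] at h4
    simpa [dotProduct_comm] using h4
  rw [Matrix.sub_mulVec, h2, Matrix.one_mulVec, dotProduct_sub, dotProduct_smul, h3] at h1
  simpa using h1

open scoped MatrixOrder in
-- If `A = S* S` is nonsingular, congruence by `S⁻¹` turns `A` into `1` and `B` into a matrix of
-- determinant `det B / (det S)²`, which reduces to the previous lemma. A singular `A` only needs `0
-- ≤ det B`.
theorem det_le_det_of_posSemidef_sub {m : Type*} [Fintype m] [DecidableEq m]
    {A B : Matrix m m ℝ} (hA : A.PosSemidef) (hB : B.PosSemidef) (hAB : (B - A).PosSemidef) :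
    A.det ≤ B.det := by
  by_cases h0 : A.det = 0
  · rw [h0]; exact hB.det_nonneg
  obtain ⟨S, rfl⟩ := CStarAlgebra.nonneg_iff_eq_star_mul_self.mp hA.nonneg
  have hS : IsUnit S.det := by
    rw [isUnit_iff_ne_zero]
    rintro h
    exact h0 (by rw [Matrix.det_mul, h, mul_zero])
  have h1 := one_le_det_of_posSemidef_sub_one (A := (S⁻¹).conjTranspose * B * S⁻¹) (by
    have := hAB.conjTranspose_mul_mul_same S⁻¹
    convert this using 1
    rw [Matrix.mul_sub, Matrix.sub_mul, Matrix.star_eq_conjTranspose]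
    congr 1
    rw [← Matrix.mul_assoc, ← Matrix.conjTranspose_mul, Matrix.mul_nonsing_inv _ hS,
      Matrix.mul_assoc, Matrix.mul_nonsing_inv _ hS]
    simp)
  rw [Matrix.det_mul, Matrix.det_mul, Matrix.det_conjTranspose, Matrix.det_nonsing_inv,
    star_trivial, Ring.inverse_eq_inv'] at h1
  rw [Matrix.det_mul, Matrix.star_eq_conjTranspose, Matrix.det_conjTranspose, star_trivial]
  have h2 : 0 < S.det * S.det := mul_self_pos.2 hS.ne_zero
  have h3 : S.det⁻¹ * B.det * S.det⁻¹ = B.det / (S.det * S.det) := by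
    field_simp
  rw [h3, le_div_iff₀ h2] at h1
  linarith

/-! ### Invariance of the index -/

theorem pullback_mem_locallyZero {X Y : Type*} [TopologicalSpace X] [TopologicalSpace Y]
    {f : X → Y} (hf : Continuous f) {k : ℕ} {φ : Cochain Y k} (hφ : φ ∈ locallyZero Y k) :
    pullback f φ ∈ locallyZero X k := by
  intro x
  obtain ⟨U, hU, h⟩ := hφ (f x)
  exact ⟨f ⁻¹' U, hf.continuousAt hU, fun t ht => h _ ht⟩

theorem pullback_mem_coboundaries {X Y : Type*} [TopologicalSpace X] [TopologicalSpace Y]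
    {f : X → Y} (hf : Continuous f) {k : ℕ} {φ : Cochain Y k} (hφ : φ ∈ coboundaries Y k) :
    pullback f φ ∈ coboundaries X k := by
  cases k with
  | zero => exact pullback_mem_locallyZero hf hφ
  | succ k =>
    obtain ⟨_, ⟨ψ, rfl⟩, χ, hχ, rfl⟩ := Submodule.mem_sup.1 hφ
    exact Submodule.mem_sup.2
      ⟨_, ⟨pullback f ψ, rfl⟩, _, pullback_mem_locallyZero hf hχ, rfl⟩

/-- The map of orbit spaces induced by an odd map. -/
def orbitSpaceMap {X Y : Type*} [InvolutiveNeg X] [InvolutiveNeg Y] (Φ : X → Y)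
    (hneg : ∀ x, Φ (-x) = -Φ x) {A : Set X} {B : Set Y} (hAB : MapsTo Φ A B) :
    OrbitSpace A → OrbitSpace B :=
  Quotient.map' hAB.restrict (by
    rintro a b (h | h)
    · exact Or.inl (congrArg Φ h)
    · exact Or.inr ((congrArg Φ h).trans (hneg _)))

theorem continuous_orbitSpaceMap {X Y : Type*} [TopologicalSpace X] [TopologicalSpace Y]
    [InvolutiveNeg X] [InvolutiveNeg Y] {Φ : X → Y} (hΦ : Continuous Φ)
    (hneg : ∀ x, Φ (-x) = -Φ x) {A : Set X} {B : Set Y} (hAB : MapsTo Φ A B) :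
    Continuous (orbitSpaceMap Φ hneg hAB) :=
  (hΦ.restrict hAB).quotient_map' _

theorem PowNonzero.image {X Y : Type*} [TopologicalSpace X] [TopologicalSpace Y]
    [InvolutiveNeg X] [InvolutiveNeg Y] (Φ : X ≃ₜ Y) (hneg : ∀ x, Φ (-x) = -Φ x)
    {A : Set X} {k : ℕ} (h : PowNonzero A k) : PowNonzero (Φ '' A) k := by
  obtain ⟨c, hc, hc', f, hf, hfc, hne⟩ := h
  have hneg' : ∀ y, Φ.symm (-y) = -Φ.symm y := fun y => by
    rw [Φ.symm_apply_eq, hneg, Φ.apply_symm_apply]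
  have hm : MapsTo Φ.symm (Φ '' A) A := by
    rintro _ ⟨a, ha, rfl⟩
    rwa [Φ.symm_apply_apply]
  -- The odd map on the image is `f ∘ Φ⁻¹`. If its class vanished, pulling back along the orbit map
  -- `A/± → Φ(A)/±` would make the original class vanish.
  refine ⟨c, hc, hc', f ∘ hm.restrict, fun a b hab => hf _ _ ?_,
    hfc.comp (Φ.symm.continuous.restrict hm), fun hmem => hne ?_⟩
  · simp [hab, hneg']
  · have := pullback_mem_coboundaries (continuous_orbitSpaceMap Φ.continuous hneg
      (mapsTo_image Φ A)) hmem
    convert this using 1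
    funext t
    simp only [pullback]
    congr 1
    funext i
    induction t i using Quotient.inductionOn' with
    | h a =>
      refine congrArg (fun a => Quotient.mk'' (f a)) (Subtype.ext ?_)
      exact (Φ.symm_apply_apply _).symm

theorem z2Index_le_image {X Y : Type*} [TopologicalSpace X] [TopologicalSpace Y]
    [InvolutiveNeg X] [InvolutiveNeg Y] [Zero X] [Zero Y] (Φ : X ≃ₜ Y)
    (hneg : ∀ x, Φ (-x) = -Φ x) (hzero : Φ 0 = 0) (A : Set X) :
    z2Index A ≤ z2Index (Φ '' A) := by
  by_cases h : (0 : Y) ∈ Φ '' A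
  · simp [z2Index, h]
  · have h' : (0 : X) ∉ A := fun h' => h ⟨0, h', hzero⟩
    rw [z2Index, z2Index, if_neg h, if_neg h']
    exact biSup_mono fun k hk => PowNonzero.image Φ hneg hk

/-! ### Functions distorted by factors close to one -/

theorem tendsto_of_eventually_le_mul {α : Type*} {l : Filter α} {f : α → ℝ≥0∞} {a : ℝ≥0∞} (m : ℕ)
    (h : ∀ μ : ℝ, 1 < μ → ∀ᶠ x in l,
      f x ≤ ENNReal.ofReal (μ ^ m) * a ∧ a ≤ ENNReal.ofReal (μ ^ m) * f x) :
    Tendsto f l (𝓝 a) := by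
  have key : ∀ b : ℝ≥0∞, b ≠ ⊤ →
      Tendsto (fun μ : ℝ => ENNReal.ofReal (μ ^ m) * b) (𝓝[>] 1) (𝓝 b) := fun b hb => by
    have h1 : Tendsto (fun μ : ℝ => ENNReal.ofReal (μ ^ m)) (𝓝[>] 1) (𝓝 1) := by
      have : Continuous fun μ : ℝ => ENNReal.ofReal (μ ^ m) :=
        ENNReal.continuous_ofReal.comp (continuous_pow m)
      simpa using (this.tendsto 1).mono_left nhdsWithin_le_nhds
    simpa using ENNReal.Tendsto.mul_const h1 (Or.inr hb)
  -- In either half the smaller of `a` and `b` is finite, so multiplying it by `μ ^ m` with `μ` near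
  -- `1` keeps it below the other. This also covers `a = ⊤`.
  refine tendsto_order.2 ⟨fun b hb => ?_, fun b hb => ?_⟩
  · obtain ⟨μ, h1, hμ⟩ :=
      (((key b hb.ne_top).eventually_lt_const hb).and self_mem_nhdsWithin).exists
    filter_upwards [h μ hμ] with x hx
    by_contra! hle
    exact (h1.trans_le (hx.2.trans (by gcongr))).false
  · obtain ⟨μ, h1, hμ⟩ :=
      (((key a hb.ne_top).eventually_lt_const hb).and self_mem_nhdsWithin).exists
    filter_upwards [h μ hμ] with x hx
    exact hx.1.trans_lt h1

section Comparison

open scoped Bundle Matrix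

variable {n : ℕ} {H : Type*} [TopologicalSpace H]
  {I : ModelWithCorners ℝ (EuclideanSpace ℝ (Fin (n + 1))) H}
  {M : Type*} [TopologicalSpace M] [ChartedSpace H M] [IsManifold I ∞ M]

/-! ### Comparison of metrics on a compact manifold -/

theorem inner_self_nonneg (g : RiemMetric I M) (x : M) (v : TangentSpace I x) :
    0 ≤ g.inner x v v := by
  by_cases hv : v = 0
  · simp [hv]
  · exact (g.pos x v hv).le

theorem inner_smul_smul_self (g : RiemMetric I M) (x : M) (c : ℝ) (v : TangentSpace I x) :
    g.inner x (c • v) (c • v) = c ^ 2 * g.inner x v v := by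
  simp only [map_smul, smul_apply, smul_eq_mul]
  ring

/-- The metric makes the tangent bundle a continuous Riemannian bundle, whose trivializations are
locally bounded. The next lemma is the same fact for their inverses; together they compare any two
metrics through the Euclidean norm. -/
theorem exists_eventually_norm_sq_le (g : RiemMetric I M) (x : M) :
    ∃ C > 0, ∀ᶠ y in 𝓝 x, ∀ v : TangentSpace I y,
      ‖(trivializationAt (EuclideanSpace ℝ (Fin (n + 1))) (TangentSpace I)
        x).continuousLinearMapAt ℝ y v‖ ^ 2 ≤ C * g.inner y v v := by
  let : Bundle.RiemannianBundle (fun x : M => TangentSpace I x) := ⟨g.toRiemannianMetric⟩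
  have : IsContinuousRiemannianBundle (EuclideanSpace ℝ (Fin (n + 1)))
    (fun x : M => TangentSpace I x) := ⟨g.inner, g.contMDiff.continuous, fun _ _ _ => rfl⟩
  obtain ⟨C, hC, h⟩ := eventually_norm_trivializationAt_lt (EuclideanSpace ℝ (Fin (n + 1)))
    (fun x : M => TangentSpace I x) x
  refine ⟨C ^ 2, by positivity, ?_⟩
  filter_upwards [h] with y hy v
  have h1 : g.inner y v v = ‖v‖ ^ 2 := real_inner_self_eq_norm_sq v
  rw [h1, ← mul_pow]
  gcongr
  exact ContinuousLinearMap.le_of_opNorm_le _ hy.le v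

theorem exists_eventually_inner_symmL_le (g : RiemMetric I M) (x : M) :
    ∃ C > 0, ∀ᶠ y in 𝓝 x, ∀ w : EuclideanSpace ℝ (Fin (n + 1)),
      g.inner y
        ((trivializationAt (EuclideanSpace ℝ (Fin (n + 1))) (TangentSpace I) x).symmL ℝ y w)
        ((trivializationAt (EuclideanSpace ℝ (Fin (n + 1))) (TangentSpace I) x).symmL ℝ y w) ≤
      C * ‖w‖ ^ 2 := by
  let : Bundle.RiemannianBundle (fun x : M => TangentSpace I x) := ⟨g.toRiemannianMetric⟩
  have : IsContinuousRiemannianBundle (EuclideanSpace ℝ (Fin (n + 1)))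
    (fun x : M => TangentSpace I x) := ⟨g.inner, g.contMDiff.continuous, fun _ _ _ => rfl⟩
  obtain ⟨C, hC, h⟩ := eventually_norm_symmL_trivializationAt_lt (EuclideanSpace ℝ (Fin (n + 1)))
    (fun x : M => TangentSpace I x) x
  refine ⟨C ^ 2, by positivity, ?_⟩
  filter_upwards [h] with y hy w
  have h1 : ∀ v : TangentSpace I y, g.inner y v v = ‖v‖ ^ 2 := fun v =>
    real_inner_self_eq_norm_sq v
  rw [h1, ← mul_pow]
  gcongr
  exact ContinuousLinearMap.le_of_opNorm_le _ hy.le w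

/-- On a compact manifold every metric is bounded by a multiple of any other. -/
theorem exists_inner_self_le [CompactSpace M] (h g : RiemMetric I M) :
    ∃ C > 0, ∀ (x : M) (v : TangentSpace I x), h.inner x v v ≤ C * g.inner x v v := by
  have hloc : ∀ x : M, ∃ C > 0, ∀ᶠ y in 𝓝 x, ∀ v : TangentSpace I y,
      h.inner y v v ≤ C * g.inner y v v := fun x => by
    obtain ⟨C, hC, h1⟩ := exists_eventually_norm_sq_le g x
    obtain ⟨D, hD, h2⟩ := exists_eventually_inner_symmL_le h x
    refine ⟨D * C, by positivity, ?_⟩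
    filter_upwards [h1, h2, (trivializationAt (EuclideanSpace ℝ (Fin (n + 1))) (TangentSpace I)
      x).open_baseSet.mem_nhds (FiberBundle.mem_baseSet_trivializationAt' x)] with y hy1 hy2 hy v
    have h3 := hy2 ((trivializationAt (EuclideanSpace ℝ (Fin (n + 1))) (TangentSpace I)
        x).continuousLinearMapAt ℝ y v)
    rw [Bundle.Trivialization.symmL_continuousLinearMapAt _ hy] at h3
    rw [mul_assoc]
    exact h3.trans (by gcongr; exact hy1 v)
  choose C hC hloc using hloc
  obtain ⟨t, -, ht⟩ := isCompact_univ.elim_nhds_subcover _ fun x _ => hloc x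
  -- The sum dominates every local constant; the `+ 1` keeps it positive when the cover is empty.
  refine ⟨∑ x ∈ t, C x + 1, by
    have := Finset.sum_nonneg fun x (_ : x ∈ t) => (hC x).le
    linarith, fun y v => ?_⟩
  obtain ⟨x, hx, hy⟩ := mem_iUnion₂.1 (ht (mem_univ y))
  refine (hy v).trans (mul_le_mul_of_nonneg_right ?_ (inner_self_nonneg g y v))
  have := Finset.single_le_sum (fun x _ => (hC x).le) hx
  linarith

theorem abs_inner_sub_inner_le {h g g' : RiemMetric I M} {δ : ℝ} (hδ : 0 ≤ δ)
    (hd : c0Dist h g g' ≤ ENNReal.ofReal δ) (x : M) (v : TangentSpace I x) :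
    |g.inner x v v - g'.inner x v v| ≤ δ * h.inner x v v := by
  by_cases hv : v = 0
  · simp [hv]
  have h0 := h.pos x v hv
  -- `c0Dist` only sees the `h`-unit ball, so `v` is normalized and the bound is rescaled by
  -- quadratic homogeneity.
  set c := (Real.sqrt (h.inner x v v))⁻¹ with hc
  have hc2 : c ^ 2 = (h.inner x v v)⁻¹ := by rw [hc, inv_pow, Real.sq_sqrt h0.le]
  have hu : h.inner x (c • v) (c • v) ≤ 1 := by
    rw [inner_smul_smul_self, hc2, inv_mul_cancel₀ h0.ne']
  have h1 : ENNReal.ofReal |g.inner x (c • v) (c • v) - g'.inner x (c • v) (c • v)| ≤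
      ENNReal.ofReal δ :=
    le_trans (le_iSup_of_le x (le_iSup_of_le (c • v) (le_iSup_of_le (c • v)
      (by rw [iSup_pos hu, iSup_pos hu])))) hd
  rw [ENNReal.ofReal_le_ofReal_iff hδ, inner_smul_smul_self, inner_smul_smul_self, ← mul_sub,
    abs_mul, hc2, abs_of_pos (inv_pos.2 h0), inv_mul_le_iff₀ h0, mul_comm] at h1
  exact h1

/-- Metrics close to `g` in the `C⁰` topology are distorted by factors close to one. -/
theorem eventually_inner_self_le [CompactSpace M] (h g : RiemMetric I M) {μ : ℝ} (hμ : 1 < μ) :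
    ∀ᶠ g' in @nhds _ (c0Topology h) g, ∀ (x : M) (v : TangentSpace I x),
      g'.inner x v v ≤ μ ^ 2 * g.inner x v v ∧ g.inner x v v ≤ μ ^ 2 * g'.inner x v v := by
  obtain ⟨C, hC, hle⟩ := exists_inner_self_le h g
  have hμ2 : 1 < μ ^ 2 := one_lt_pow₀ hμ two_ne_zero
  -- With this `δ`, `|g' - g| ≤ δ h ≤ δ C g = (1 - μ⁻²) g`, so `μ⁻² g ≤ g' ≤ (2 - μ⁻²) g`.
  set δ := (1 - (μ ^ 2)⁻¹) / C with hδ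
  have hδ0 : 0 < δ := div_pos (sub_pos.2 (inv_lt_one_of_one_lt₀ hμ2)) hC
  let := c0PseudoEMetricSpace h
  filter_upwards [Metric.eball_mem_nhds g (ENNReal.ofReal_pos.2 hδ0)] with g' hg' x v
  have h1 : c0Dist h g' g ≤ ENNReal.ofReal δ := le_of_lt hg'
  have h2 := abs_le.1 (abs_inner_sub_inner_le hδ0.le h1 x v)
  have h3 := mul_le_mul_of_nonneg_left (hle x v) hδ0.le
  have h4 : δ * (C * g.inner x v v) = (1 - (μ ^ 2)⁻¹) * g.inner x v v := by
    rw [hδ]; field_simp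
  have h5 := inner_self_nonneg g x v
  -- This is `t + t⁻¹ ≥ 2` for `t = μ ^ 2`.
  have h6 : 1 + (1 - (μ ^ 2)⁻¹) ≤ μ ^ 2 := by
    have : (μ ^ 2) * (μ ^ 2)⁻¹ = 1 := mul_inv_cancel₀ (by positivity)
    have h7 : 0 < (μ ^ 2)⁻¹ := by positivity
    nlinarith [mul_nonneg h7.le (sq_nonneg (μ ^ 2 - 1))]
  constructor
  · nlinarith [mul_le_mul_of_nonneg_right h6 h5]
  · have h7 : (μ ^ 2)⁻¹ * g.inner x v v ≤ g'.inner x v v := by linarith [h2.1]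
    rwa [inv_mul_le_iff₀ (by positivity)] at h7

/-! ### Comparison of volumes and covectors -/

/-- The `g'`-unit ball lies in `μ` times the `g`-unit ball. -/
theorem conorm_le {g g' : RiemMetric I M} {μ : ℝ} (hμ : 0 < μ) {x : M}
    (hle : ∀ v : TangentSpace I x, g.inner x v v ≤ μ ^ 2 * g'.inner x v v)
    (η : TangentSpace I x →L[ℝ] ℝ) : conorm g' x η ≤ ENNReal.ofReal μ * conorm g x η := by
  refine iSup₂_le fun v hv => ?_
  have h1 : g.inner x (μ⁻¹ • v) (μ⁻¹ • v) ≤ 1 := by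
    rw [inner_smul_smul_self, inv_pow, inv_mul_le_iff₀ (by positivity)]
    exact (hle v).trans (by gcongr)
  refine le_trans ?_ (mul_le_mul_right (le_iSup₂ (f := fun (v : TangentSpace I x)
    (_ : g.inner x v v ≤ 1) => ENNReal.ofReal |η v|) (μ⁻¹ • v) h1) _)
  rw [← ENNReal.ofReal_mul hμ.le, map_smul, smul_eq_mul, abs_mul, abs_of_pos (inv_pos.2 hμ),
    mul_inv_cancel_left₀ hμ.ne']

/-- Through this identity, inequalities between metrics become inequalities between Gram matrices in
the positive semidefinite order. Injectivity of `chartInvDeriv` plays no role, since the determinant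
comparison allows singular matrices. -/
theorem dotProduct_gram_mulVec (g : RiemMetric I M) (x : M) (y : EuclideanSpace ℝ (Fin (n + 1)))
    (z : Fin (n + 1) → ℝ) :
    z ⬝ᵥ gram g x y *ᵥ z = g.inner ((extChartAt I x).symm y)
      (chartInvDeriv I x y (WithLp.toLp 2 z)) (chartInvDeriv I x y (WithLp.toLp 2 z)) := by
  have hz : WithLp.toLp 2 z = ∑ i, z i • EuclideanSpace.single i (1 : ℝ) := by
    ext j
    simp [Finset.sum_apply, Pi.single_apply]
  rw [hz, map_sum, map_sum]
  refine Finset.sum_congr rfl fun i _ => ?_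
  rw [g.symm, map_sum, Matrix.mulVec, dotProduct, Finset.mul_sum]
  refine Finset.sum_congr rfl fun j _ => ?_
  simp only [map_smul, smul_apply, smul_eq_mul, gram, Matrix.of_apply]
  ring

theorem gram_isHermitian (g : RiemMetric I M) (x : M) (y : EuclideanSpace ℝ (Fin (n + 1))) :
    (gram g x y).IsHermitian :=
  Matrix.IsHermitian.ext fun _ _ => g.symm _ _ _

theorem gram_posSemidef (g : RiemMetric I M) (x : M) (y : EuclideanSpace ℝ (Fin (n + 1))) :
    (gram g x y).PosSemidef :=
  .of_dotProduct_mulVec_nonneg (gram_isHermitian g x y) fun z => by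
    rw [star_trivial, dotProduct_gram_mulVec]
    exact inner_self_nonneg _ _ _

theorem sqrt_det_gram_le {g g' : RiemMetric I M} {μ : ℝ} (hμ : 0 < μ)
    (hle : ∀ (x : M) (v : TangentSpace I x), g'.inner x v v ≤ μ ^ 2 * g.inner x v v)
    (x : M) (y : EuclideanSpace ℝ (Fin (n + 1))) :
    Real.sqrt (gram g' x y).det ≤ μ ^ (n + 1) * Real.sqrt (gram g x y).det := by
  have h1 := det_le_det_of_posSemidef_sub (gram_posSemidef g' x y)
    ((gram_posSemidef g x y).smul (sq_nonneg μ)) (.of_dotProduct_mulVec_nonneg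
      (((gram_posSemidef g x y).smul (sq_nonneg μ)).isHermitian.sub (gram_isHermitian g' x y))
      fun z => by
        rw [star_trivial, Matrix.sub_mulVec, dotProduct_sub, Matrix.smul_mulVec, dotProduct_smul,
          dotProduct_gram_mulVec, dotProduct_gram_mulVec, sub_nonneg]
        exact hle _ _)
  -- The matrices have size `n + 1`, so the factor is `(μ²)^(n+1)`, whose square root is `μ^(n+1)`.
  rw [Matrix.det_smul, Fintype.card_fin, ← pow_mul, mul_comm 2, pow_mul] at h1
  refine (Real.sqrt_le_sqrt h1).trans ?_
  rw [Real.sqrt_mul (sq_nonneg _), Real.sqrt_sq (by positivity)]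

/-- The two-sided hypothesis removes any measurability condition on `f`, which will be the inverse
of a chart. -/
theorem map_le_map_of_le_smul {α β : Type*} [MeasurableSpace α] [MeasurableSpace β]
    {μ ν : Measure α} {c d : ℝ≥0∞} (h : μ ≤ c • ν) (h' : ν ≤ d • μ) (f : α → β) :
    μ.map f ≤ c • ν.map f := by
  by_cases hf : AEMeasurable f ν
  · have hf' : AEMeasurable f μ := hf.mono_ac (Measure.absolutelyContinuous_of_le_smul h)
    refine Measure.le_iff.2 fun s hs => ?_
    rw [Measure.smul_apply, Measure.map_apply_of_aemeasurable hf' hs,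
      Measure.map_apply_of_aemeasurable hf hs]
    exact h _
  -- By `h'`, `f` is not a.e. measurable for `μ` either, and `Measure.map` then takes its default
  -- value `0`.
  · have hf' : ¬ AEMeasurable f μ := fun hf' =>
      hf (hf'.mono_ac (Measure.absolutelyContinuous_of_le_smul h'))
    rw [Measure.map_of_not_aemeasurable hf']
    exact Measure.zero_le _

theorem withDensity_le_smul {α : Type*} [MeasurableSpace α] {ν : Measure α} {f f' : α → ℝ}
    {c : ℝ} (hc : 0 ≤ c) (h : ∀ y, f' y ≤ c * f y) :
    ν.withDensity (fun y => ENNReal.ofReal (f' y)) ≤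
      ENNReal.ofReal c • ν.withDensity fun y => ENNReal.ofReal (f y) := by
  rw [← withDensity_smul' _ _ ENNReal.ofReal_ne_top]
  refine withDensity_mono (Eventually.of_forall fun y => ?_)
  rw [Pi.smul_apply, smul_eq_mul, ← ENNReal.ofReal_mul hc]
  exact ENNReal.ofReal_le_ofReal (h y)

theorem vol_le_smul [MeasurableSpace M] {g g' : RiemMetric I M} {μ : ℝ} (hμ : 0 < μ)
    (hle : ∀ (x : M) (v : TangentSpace I x), g'.inner x v v ≤ μ ^ 2 * g.inner x v v)
    (hle' : ∀ (x : M) (v : TangentSpace I x), g.inner x v v ≤ μ ^ 2 * g'.inner x v v) :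
    vol g' ≤ ENNReal.ofReal (μ ^ (n + 1)) • vol g := by
  refine iSup_le fun x => (map_le_map_of_le_smul
    (withDensity_le_smul (by positivity) (sqrt_det_gram_le hμ hle x))
    (withDensity_le_smul (by positivity) (sqrt_det_gram_le hμ hle' x)) _).trans ?_
  gcongr
  exact le_iSup (chartVol g) x

end Comparison

section Transfer

variable {n : ℕ} {H : Type*} [TopologicalSpace H]
  {I : ModelWithCorners ℝ (EuclideanSpace ℝ (Fin (n + 1))) H}
  {M : Type*} [TopologicalSpace M] [ChartedSpace H M] [IsManifold I ∞ M]

/-! ### Sobolev spaces and energies of comparable metrics -/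

/-- The metrics `g` and `g'` distort each other by factors of at most `μ`. -/
structure Comparable (μ : ℝ) (g g' : RiemMetric I M) : Prop where
  one_le : 1 ≤ μ
  le : ∀ (x : M) (v : TangentSpace I x), g'.inner x v v ≤ μ ^ 2 * g.inner x v v
  ge : ∀ (x : M) (v : TangentSpace I x), g.inner x v v ≤ μ ^ 2 * g'.inner x v v

variable {μ : ℝ} {g g' : RiemMetric I M}

theorem Comparable.symm (h : Comparable μ g g') : Comparable μ g' g := ⟨h.one_le, h.ge, h.le⟩

theorem Comparable.pos (h : Comparable μ g g') : 0 < μ := one_pos.trans_le h.one_le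

/-- The `L²` and potential terms scale like volume, with exponent `n + 1`; they are weakened to the
exponent `n + 3` of the Dirichlet term. -/
theorem Comparable.ofReal_pow_le (h : Comparable μ g g') :
    ENNReal.ofReal (μ ^ (n + 1)) ≤ ENNReal.ofReal (μ ^ (n + 3)) :=
  ENNReal.ofReal_le_ofReal (pow_le_pow_right₀ h.one_le (by omega))

variable [MeasurableSpace M]

theorem Comparable.vol_le (h : Comparable μ g g') :
    vol g' ≤ ENNReal.ofReal (μ ^ (n + 1)) • vol g :=
  vol_le_smul h.pos h.le h.ge

theorem Comparable.ac (h : Comparable μ g g') : vol g' ≪ vol g :=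
  Measure.absolutelyContinuous_of_le_smul h.vol_le

theorem Comparable.lintegral_le (h : Comparable μ g g') (f : M → ℝ≥0∞) :
    ∫⁻ q, f q ∂(vol g') ≤ ENNReal.ofReal (μ ^ (n + 1)) * ∫⁻ q, f q ∂(vol g) := by
  refine (lintegral_mono' h.vol_le le_rfl).trans_eq ?_
  rw [lintegral_smul_measure, smul_eq_mul]

/-- Weak differentials are defined in charts without reference to a metric, so every competitor `(v,
η)` for `g` is one for `g'`. The exponent is `n + 1` from the volume plus `2` from the squared
conorm. -/
theorem Comparable.dirichlet_le (h : Comparable μ g g') {u : Lp ℝ 2 (vol g)}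
    {u' : Lp ℝ 2 (vol g')} (hu : u' =ᵐ[vol g'] u) :
    dirichlet g' u' ≤ ENNReal.ofReal (μ ^ (n + 3)) * dirichlet g u := by
  have h0 : ENNReal.ofReal (μ ^ (n + 3)) ≠ 0 := by
    rw [ENNReal.ofReal_ne_zero_iff]; exact pow_pos h.pos _
  simp only [dirichlet, ENNReal.mul_iInf_of_ne h0 ENNReal.ofReal_ne_top]
  refine le_iInf fun v => le_iInf fun η => le_iInf fun hv => le_iInf fun hη =>
    iInf_le_of_le v (iInf_le_of_le η (iInf_le_of_le ((h.ac.ae_eq hv).trans hu.symm)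
      (iInf_le_of_le hη ((h.lintegral_le _).trans ?_))))
  calc ENNReal.ofReal (μ ^ (n + 1)) * ∫⁻ q, conorm g' q (η q) ^ 2 ∂(vol g)
      ≤ ENNReal.ofReal (μ ^ (n + 1)) *
          ∫⁻ q, ENNReal.ofReal μ ^ 2 * conorm g q (η q) ^ 2 ∂(vol g) := by
        gcongr with q
        rw [← mul_pow]
        gcongr
        exact conorm_le h.pos (h.ge q) (η q)
    _ = ENNReal.ofReal (μ ^ (n + 3)) * ∫⁻ q, conorm g q (η q) ^ 2 ∂(vol g) := by
        rw [lintegral_const_mul' _ _ (ENNReal.pow_ne_top ENNReal.ofReal_ne_top), ← mul_assoc,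
          ← ENNReal.ofReal_pow h.pos.le, ← ENNReal.ofReal_mul (pow_pos h.pos _).le, ← pow_add]

theorem Comparable.enorm_sq_le (h : Comparable μ g g') {u : Lp ℝ 2 (vol g)}
    {u' : Lp ℝ 2 (vol g')} (hu : u' =ᵐ[vol g'] u) :
    ‖u'‖ₑ ^ 2 ≤ ENNReal.ofReal (μ ^ (n + 3)) * ‖u‖ₑ ^ 2 := by
  have key : ∀ (ν : Measure M) (w : Lp ℝ 2 ν), ‖w‖ₑ ^ 2 = ∫⁻ q, ‖w q‖ₑ ^ 2 ∂ν := fun ν w => by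
    have h1 := eLpNorm_nnreal_pow_eq_lintegral (f := w) (μ := ν) (p := 2) two_ne_zero
    rw [Lp.enorm_def]
    simpa using h1
  rw [key, key]
  calc ∫⁻ q, ‖u' q‖ₑ ^ 2 ∂(vol g') = ∫⁻ q, ‖u q‖ₑ ^ 2 ∂(vol g') :=
        lintegral_congr_ae (hu.mono fun q hq => by simp only [hq])
    _ ≤ _ := (h.lintegral_le _).trans (by gcongr ?_ * _; exact h.ofReal_pow_le)

theorem Comparable.memLp (h : Comparable μ g g') (u : Lp ℝ 2 (vol g)) : MemLp u 2 (vol g') :=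
  (Lp.memLp u).of_measure_le_smul ENNReal.ofReal_ne_top h.vol_le

/-- The class in `H¹(M, g')` of a function in `H¹(M, g)`. -/
def Comparable.toFun (h : Comparable μ g g') (u : SobolevH1 g) : SobolevH1 g' :=
  ⟨(h.memLp u.1).toLp u.1,
    (h.dirichlet_le (MemLp.coeFn_toLp (h.memLp u.1))).trans_lt
      (ENNReal.mul_lt_top ENNReal.ofReal_lt_top u.2)⟩

theorem Comparable.coeFn_toFun (h : Comparable μ g g') (u : SobolevH1 g) :
    (h.toFun u).1 =ᵐ[vol g'] u.1 := MemLp.coeFn_toLp (h.memLp u.1)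

/-- The two volumes have the same null sets, so a.e. equality passes between them. -/
theorem Comparable.symm_toFun_toFun (h : Comparable μ g g') (u : SobolevH1 g) :
    h.symm.toFun (h.toFun u) = u :=
  Subtype.ext (Lp.ext ((h.symm.coeFn_toFun _).trans (h.symm.ac.ae_eq (h.coeFn_toFun u))))

theorem Comparable.toFun_neg (h : Comparable μ g g') (u : SobolevH1 g) :
    h.toFun (-u) = -h.toFun u := by
  refine Subtype.ext (Lp.ext ?_)
  have h1 : (-h.toFun u).1 =ᵐ[vol g'] -(h.toFun u).1 := Lp.coeFn_neg _
  have h2 : (-u).1 =ᵐ[vol g] -u.1 := Lp.coeFn_neg _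
  filter_upwards [h.coeFn_toFun (-u), h.coeFn_toFun u, h1, h.ac.ae_eq h2] with q e1 e2 e3 e4
  rw [e1, e3, e4, Pi.neg_apply, Pi.neg_apply, e2]

theorem Comparable.toFun_zero (h : Comparable μ g g') : h.toFun 0 = 0 := by
  refine Subtype.ext (Lp.ext ?_)
  have h1 : (0 : SobolevH1 g').1 =ᵐ[vol g'] 0 := Lp.coeFn_zero _ _ _
  have h2 : (0 : SobolevH1 g).1 =ᵐ[vol g] 0 := Lp.coeFn_zero _ _ _
  exact (h.coeFn_toFun 0).trans ((h.ac.ae_eq h2).trans h1.symm)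

theorem Comparable.h1Dist_le (h : Comparable μ g g') (u v : SobolevH1 g) :
    h1Dist (h.toFun u) (h.toFun v) ≤
      ENNReal.ofReal (μ ^ (n + 3)) ^ (1 / 2 : ℝ) * h1Dist u v := by
  have hsub : ⇑((h.toFun u).1 - (h.toFun v).1) =ᵐ[vol g'] ⇑(u.1 - v.1) := by
    filter_upwards [h.coeFn_toFun u, h.coeFn_toFun v,
      Lp.coeFn_sub (h.toFun u).1 (h.toFun v).1, h.ac.ae_eq (Lp.coeFn_sub u.1 v.1)]
      with q e1 e2 e3 e4
    rw [e3, e4, Pi.sub_apply, Pi.sub_apply, e1, e2]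
  rw [h1Dist, h1Dist, ← ENNReal.mul_rpow_of_nonneg _ _ (by norm_num), mul_add]
  exact ENNReal.rpow_le_rpow (add_le_add (h.enorm_sq_le hsub) (h.dirichlet_le hsub)) (by norm_num)

theorem isOpen_sobolevH1_iff {U : Set (SobolevH1 g)} :
    IsOpen U ↔ ∀ u ∈ U, ∃ r : ℝ≥0∞, 0 < r ∧ ∀ v, h1Dist u v < r → v ∈ U :=
  Iff.rfl

/-- Preimages of open sets are checked directly against the definition of the topology, so no
triangle inequality for `h1Dist` is needed. -/
theorem continuous_of_h1Dist_le {f : SobolevH1 g → SobolevH1 g'} {K : ℝ≥0∞} (hK0 : K ≠ 0)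
    (hKt : K ≠ ⊤) (hf : ∀ u v, h1Dist (f u) (f v) ≤ K * h1Dist u v) : Continuous f := by
  refine continuous_def.2 fun U hU => isOpen_sobolevH1_iff.2 fun u hu => ?_
  obtain ⟨r, hr, hrU⟩ := isOpen_sobolevH1_iff.1 hU (f u) hu
  refine ⟨r / K, ENNReal.div_pos hr.ne' hKt, fun v hv => hrU (f v) ((hf u v).trans_lt ?_)⟩
  rwa [ENNReal.lt_div_iff_mul_lt (Or.inl hK0) (Or.inl hKt), mul_comm] at hv

theorem Comparable.continuous_toFun (h : Comparable μ g g') : Continuous h.toFun := by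
  refine continuous_of_h1Dist_le ?_ ?_ h.h1Dist_le
  · rw [Ne, ENNReal.rpow_eq_zero_iff_of_pos (by norm_num), ENNReal.ofReal_eq_zero, not_le]
    exact pow_pos h.pos _
  · exact ENNReal.rpow_ne_top_of_nonneg (by norm_num) ENNReal.ofReal_ne_top

/-- The Sobolev spaces of comparable metrics are homeomorphic. -/
def Comparable.homeomorph (h : Comparable μ g g') : SobolevH1 g ≃ₜ SobolevH1 g' where
  toFun := h.toFun
  invFun := h.symm.toFun
  left_inv := h.symm_toFun_toFun
  right_inv := h.symm.symm_toFun_toFun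
  continuous_toFun := h.continuous_toFun
  continuous_invFun := h.symm.continuous_toFun

theorem Comparable.energy_le (h : Comparable μ g g') (W : ℝ → ℝ) (ε : ℝ) (u : SobolevH1 g) :
    energy g' W ε (h.toFun u) ≤ ENNReal.ofReal (μ ^ (n + 3)) * energy g W ε u := by
  rw [energy, energy, mul_add, mul_left_comm]
  refine add_le_add (by gcongr; exact h.dirichlet_le (h.coeFn_toFun u)) ?_
  calc ∫⁻ q, ENNReal.ofReal (W ((h.toFun u).1 q) / ε) ∂(vol g')
      = ∫⁻ q, ENNReal.ofReal (W (u.1 q) / ε) ∂(vol g') :=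
        lintegral_congr_ae ((h.coeFn_toFun u).mono fun q hq => by simp only [hq])
    _ ≤ _ := (h.lintegral_le _).trans (by gcongr ?_ * _; exact h.ofReal_pow_le)

theorem Comparable.image_mem_minmaxFamily (h : Comparable μ g g') {p : ℕ}
    {A : Set (SobolevH1 g)} (hA : A ∈ minmaxFamily g p) :
    h.homeomorph '' A ∈ minmaxFamily g' p := by
  refine ⟨hA.1.image h.homeomorph.continuous, ?_,
    hA.2.2.trans (z2Index_le_image h.homeomorph h.toFun_neg h.toFun_zero A)⟩
  rintro _ ⟨u, hu, rfl⟩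
  exact ⟨-u, hA.2.1 u hu, h.toFun_neg u⟩

/-- Each competitor for `g` is transported to one for `g'`. The factor does not depend on `ε`, which
is what lets it pass to the limits. -/
theorem Comparable.minmaxValue_le (h : Comparable μ g g') (W : ℝ → ℝ) (p : ℕ) (ε : ℝ) :
    minmaxValue g' W p ε ≤ ENNReal.ofReal (μ ^ (n + 3)) * minmaxValue g W p ε := by
  have h0 : ENNReal.ofReal (μ ^ (n + 3)) ≠ 0 := by
    rw [ENNReal.ofReal_ne_zero_iff]; exact pow_pos h.pos _
  simp only [minmaxValue, ENNReal.mul_iInf_of_ne h0 ENNReal.ofReal_ne_top]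
  refine le_iInf₂ fun A hA => iInf₂_le_of_le _ (h.image_mem_minmaxFamily hA) (iSup₂_le ?_)
  rintro _ ⟨u, hu, rfl⟩
  refine (h.energy_le W ε u).trans ?_
  gcongr
  exact le_iSup₂ (f := fun u (_ : u ∈ A) => energy g W ε u) u hu

theorem Comparable.lowerSpectrum_le (h : Comparable μ g g') (W : ℝ → ℝ) (p : ℕ) :
    lowerSpectrum W p g' ≤ ENNReal.ofReal (μ ^ (n + 3)) * lowerSpectrum W p g := by
  rw [lowerSpectrum, lowerSpectrum, mul_left_comm,
    ← ENNReal.liminf_const_mul_of_ne_top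
      (a := ENNReal.ofReal (μ ^ (n + 3))) ENNReal.ofReal_ne_top]
  gcongr
  exact liminf_le_liminf (Eventually.of_forall (h.minmaxValue_le W p))

theorem Comparable.upperSpectrum_le (h : Comparable μ g g') (W : ℝ → ℝ) (p : ℕ) :
    upperSpectrum W p g' ≤ ENNReal.ofReal (μ ^ (n + 3)) * upperSpectrum W p g := by
  rw [upperSpectrum, upperSpectrum, mul_left_comm,
    ← ENNReal.limsup_const_mul_of_ne_top
      (a := ENNReal.ofReal (μ ^ (n + 3))) ENNReal.ofReal_ne_top]
  gcongr
  exact limsup_le_limsup (Eventually.of_forall (h.minmaxValue_le W p))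

end Transfer

/-! ### Continuity in the `C⁰` topology -/

section Continuity

variable {n : ℕ} {H : Type*} [TopologicalSpace H]
  {I : ModelWithCorners ℝ (EuclideanSpace ℝ (Fin (n + 1))) H}
  {M : Type*} [TopologicalSpace M] [ChartedSpace H M] [IsManifold I ∞ M] [CompactSpace M]

theorem eventually_comparable (h g : RiemMetric I M) {μ : ℝ} (hμ : 1 < μ) :
    ∀ᶠ g' in @nhds _ (c0Topology h) g, Comparable μ g g' :=
  (eventually_inner_self_le h g hμ).mono fun _ hg' =>
    ⟨hμ.le, fun x v => (hg' x v).1, fun x v => (hg' x v).2⟩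

/-- A functional of the metric that is distorted by a bounded power of the distortion of the metric
is continuous in the `C⁰` topology. -/
theorem continuous_of_comparable (h : RiemMetric I M) (m : ℕ) {F : RiemMetric I M → ℝ≥0∞}
    (hF : ∀ (μ : ℝ) (g g' : RiemMetric I M), Comparable μ g g' →
      F g' ≤ ENNReal.ofReal (μ ^ m) * F g) :
    Continuous[c0Topology h, inferInstance] F := by
  let := c0Topology h
  exact continuous_iff_continuousAt.2 fun g => tendsto_of_eventually_le_mul m fun μ hμ =>
    -- Symmetry of comparability turns the one-sided bound `hF` into the two-sided one.
    (eventually_comparable h g hμ).mono fun g' hg' => ⟨hF _ _ _ hg', hF _ _ _ hg'.symm⟩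

end Continuity

end AllenCahn

end

theorem mainTheorem8 {n : ℕ} (hn : 2 ≤ n) {H : Type*} [TopologicalSpace H]
    (I : ModelWithCorners ℝ (EuclideanSpace ℝ (Fin (n + 1))) H)
    (M : Type*) [TopologicalSpace M] [ChartedSpace H M] [IsManifold I ∞ M]
    [CompactSpace M] [T2Space M] [MeasurableSpace M] [BorelSpace M]
    (W : ℝ → ℝ) (hW : AllenCahn.IsDoubleWell W) (p : ℕ) (h : AllenCahn.RiemMetric I M) :
    Continuous[AllenCahn.c0Topology h, inferInstance]
        (AllenCahn.lowerSpectrum W p : AllenCahn.RiemMetric I M → ℝ≥0∞) ∧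
      Continuous[AllenCahn.c0Topology h, inferInstance]
        (AllenCahn.upperSpectrum W p : AllenCahn.RiemMetric I M → ℝ≥0∞) := by
  exact ⟨AllenCahn.continuous_of_comparable h (n + 3) fun _ _ _ hc => hc.lowerSpectrum_le W p,
    AllenCahn.continuous_of_comparable h (n + 3) fun _ _ _ hc => hc.upperSpectrum_le W p⟩
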